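/- **Setting.** For $n\in\mathbb N_0$ let $P_n(x)=\frac{1}{2^n n!}\frac{d^n}{dx^n}(x^2-1)^n$, let $P_n^k(x)=(1-x^2)^{k/2}\frac{d^k}{dx^k}P_n(x)$ for $0\le k\le n$ and $P_n^k=(-1)^k\frac{(n+k)!}{(n-k)!}P_n^{-k}$ for $-n\le k<0$, and let $$Y_n^k(\theta,\varphi)=(-1)^k\sqrt{\frac{2n+1}{4\pi}\frac{(n-k)!}{(n+k)!}}\;P_n^k(\cos\theta)\,e^{\mathrm i k\varphi},\qquad |k|\le n,$$ be the spherical harmonics on $\mathbb S^2$ in the coordinates $(\sin\theta\cos\varphi,\sin\theta\sin\varphi,\cos\theta)$. For integers $K\ge 1$, $n\ge0$, $|k|\le n$ put $$\zeta_{n,k}^K=\eta\,\nu\,\sqrt{\frac1{2^p}\binom{p}{\frac{p-k}{2}}}\ \text{ if } |k|\le K-1,\qquad \zeta_{n,k}^K=0\ \text{ if } |k|\ge K,$$ where $\eta=1$ if $K-1$ is even and $\eta=\mathrm i$ if $K-1$ is odd; $\nu=1$ if $K+k$ is odd and $\nu=0$ if $K+k$ is even (in which case $\zeta_{n,k}^K=0$);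 $p=\min(K-1,n-1)$ if $K+n$ is even and $p=\min(K-1,n)$ if $K+n$ is odd. For a function $\kappa:[0,\infty)\to\mathbb R$ with $\emptyset\ne\operatorname{supp}(\kappa)\subset[1/2,2]$ and an integer $N\ge 1$, the directional wavelet is $$\Psi_K^N=\sum_{n=0}^\infty\sum_{k=-n}^n\sqrt{\frac{2n+1}{8\pi^2}}\;\kappa\!\left(\frac nN\right)\zeta_{n,k}^K\,Y_n^k .$$ **Proposition (localization bound for directional wavelets).** Let $K\ge1$ and $q\ge1$ be integers and let $\kappa$ be as above with $\kappa\in C^{3q-1}([0,\infty))$. Then there exists a constant $c=c(\kappa,K,q)>0$ such that for all integers $N\ge1$, all $\theta\in[0,\pi]$ and all $\varphi\in[0,2\pi)$, $$|\Psi_K^N(\theta,\varphi)|\le\frac{cN^2}{(1+N\theta)^q}\sum_{k=0}^{K-1}(N\sin\theta)^k ,$$ and in particular $$|\Psi_K^N(\theta,\varphi)|\le\frac{cN^2}{(1+N\theta)^{q+1-K}} .$$ (The term $k=0$ of the sum equals $1$.) -/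

import Mathlib

namespace DirectionalWavelet

open Polynomial in
/-- The Legendre polynomial `P_n`, by the Rodrigues formula. -/
noncomputable def legendreP (n : ℕ) : ℝ[X] :=
  C (1 / (2 ^ n * (n.factorial : ℝ))) * derivative^[n] ((X ^ 2 - 1) ^ n)

/-- The associated Legendre function of nonnegative order `k`,
`(1 - x ^ 2) ^ (k / 2) * (d / dx) ^ k P_n`, for `x ∈ [-1, 1]`. -/
noncomputable def assocLegendreNat (n k : ℕ) (x : ℝ) : ℝ :=
  Real.sqrt (1 - x ^ 2) ^ k * (Polynomial.derivative^[k] (legendreP n)).eval x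

/-- The associated Legendre function `P_n^k` of degree `n` and order `k ∈ {-n, ..., n}`;
for `k < 0` it is `(-1) ^ k * (n + k)! / (n - k)! * P_n^{-k}`. -/
noncomputable def assocLegendre (n : ℕ) (k : ℤ) (x : ℝ) : ℝ :=
  if 0 ≤ k then assocLegendreNat n k.toNat x
  else (-1 : ℝ) ^ k *
    ((((n : ℤ) + k).toNat.factorial : ℝ) / (((n : ℤ) - k).toNat.factorial : ℝ)) *
    assocLegendreNat n (-k).toNat x

/-- The spherical harmonic `Y_n^k`, `k ∈ {-n, ..., n}`, in the spherical coordinates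
`(sin θ cos φ, sin θ sin φ, cos θ)`. -/
noncomputable def sphericalHarmonic (n : ℕ) (k : ℤ) (θ φ : ℝ) : ℂ :=
  (-1 : ℂ) ^ k *
    (Real.sqrt ((2 * (n : ℝ) + 1) / (4 * Real.pi) *
      ((((n : ℤ) - k).toNat.factorial : ℝ) / (((n : ℤ) + k).toNat.factorial : ℝ))) : ℂ) *
    (assocLegendre n k (Real.cos θ) : ℂ) *
    Complex.exp (Complex.I * (k : ℂ) * (φ : ℂ))

/-- The phase `η`. -/
noncomputable def eta (K : ℕ) : ℂ := if Even (K - 1) then 1 else Complex.I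

/-- The parity factor `ν`. -/
noncomputable def nu (K : ℕ) (k : ℤ) : ℂ := if Odd ((K : ℤ) + k) then 1 else 0

/-- The number `p`. The subtraction `n - 1` truncates only for `n = 0` and `K` even, where the
only order `k = 0` has `ν = 0`. -/
def binomTop (K n : ℕ) : ℕ := if Even (K + n) then min (K - 1) (n - 1) else min (K - 1) n

/-- The directionality component `ζ_{n,k}^K`, for `|k| ≤ n`. Where `ν = 1`, one has `|k| ≤ p`
and `p - k` is even, so the lower entry of the binomial coefficient is the honest
`(p - k) / 2`. -/
noncomputable def directionality (K n : ℕ) (k : ℤ) : ℂ :=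
  if |k| ≤ (K : ℤ) - 1 then
    eta K * nu K k *
      (Real.sqrt (1 / 2 ^ binomTop K n *
        ((binomTop K n).choose (((binomTop K n : ℤ) - k) / 2).toNat : ℝ)) : ℂ)
  else 0

/-- `κ : [0, ∞) → ℝ` is a window function of class `C^r` on `[0, ∞)`, with nonempty support
contained in `[1/2, 2]`. Values of `κ` at negative numbers are irrelevant. -/
structure IsWindow (r : ℕ) (κ : ℝ → ℝ) : Prop where
  contDiffOn : ContDiffOn ℝ r κ (Set.Ici 0)
  support_nonempty : (closure (Function.support κ ∩ Set.Ici 0)).Nonempty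
  support_subset : closure (Function.support κ ∩ Set.Ici 0) ⊆ Set.Icc (1 / 2) 2

/-- The directional wavelet `Ψ_K^N` at the point with spherical coordinates `(θ, φ)`. If `κ` is a
window function and `1 ≤ N`, then only the terms with `N / 2 ≤ n ≤ 2 * N` can be nonzero. -/
noncomputable def wavelet (κ : ℝ → ℝ) (K N : ℕ) (θ φ : ℝ) : ℂ :=
  ∑' n : ℕ, ∑ k ∈ Finset.Icc (-(n : ℤ)) (n : ℤ),
    (Real.sqrt ((2 * (n : ℝ) + 1) / (8 * Real.pi ^ 2)) : ℂ) * (κ ((n : ℝ) / (N : ℝ)) : ℂ) *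
      directionality K n k * sphericalHarmonic n k θ φ

end DirectionalWavelet

namespace DirectionalWavelet
-- Recurrences and pointwise bounds for Legendre polynomials.
section Legendre
open Polynomial

/-! Only orders `|k| < K` occur. Grouped by order, the wavelet is a finite sum of bounded phases
times `sin θ ^ |k|` times a kernel `∑ (2n+1) g(n) P_n^{(|k|)}(cos θ)` with `g(n) = κ(n/N) W(n)`
(`wavelet_eq_sum`). The weight `W` behaves like a symbol of order `-|k|` in `n`, and `κ(n/N)` like
one of order `0` uniformly in `N`.

Decay in `θ` comes from summation by parts. Multiplying the kernel by `1 - x` replaces `g` by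
`legendreStep k g` (`sum_iterate_legendreStep`), essentially a second difference, so the symbol
order drops by two (`IsSymbol.legendreStep`). After `m` steps the terms with `n ~ N` are at most a
constant times `N · N^{-|k|-2m} · N^{2|k|}`, by the crude bound `|P_n^{(k)}| ≤ n^{2k}`, and there
are `O(N)` of them. Hence `(1 - cos θ)^m |kernel| ≤ C N^{2+|k|-2m}`. As `1 - cos θ` is comparable to
`θ²`, this together with the case `m = 0` gives the factor `(1 + Nθ)^{-q}`, and `N^{|k|}` merges
with `sin θ ^ |k|`. The second estimate follows from `sin θ ≤ θ`. -/

theorem iterate_derivative_X_mul_eq (p : ℝ[X]) (n : ℕ) :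
    derivative^[n] (X * p) = X * derivative^[n] p + n • derivative^[n - 1] p := by
  rw [mul_comm, iterate_derivative_mul_X, mul_comm]

theorem iterate_derivative_X_sq_sub_one_mul (p : ℝ[X]) (n : ℕ) :
    derivative^[n + 1] ((X ^ 2 - 1) * p) = (X ^ 2 - 1) * derivative^[n + 1] p +
      C (2 * ((n : ℝ) + 1)) * X * derivative^[n] p +
      C (((n : ℝ) + 1) * n) * derivative^[n - 1] p := by
  have h : (X ^ 2 - 1) * p = X * (X * p) - p := by ring
  rw [h, iterate_derivative_sub, iterate_derivative_X_mul_eq, iterate_derivative_X_mul_eq,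
    Nat.add_sub_cancel, iterate_derivative_X_mul_eq]
  simp only [nsmul_eq_mul, map_mul, map_add, map_natCast, map_one, Nat.cast_add, Nat.cast_one,
    C_ofNat]
  ring

/-- The derivative of order `n - 1` in the Rodrigues formula, scaled by `n`. -/
noncomputable def legendreAux (n : ℕ) : ℝ[X] :=
  C ((n : ℝ) / (2 ^ n * (n.factorial : ℝ))) * derivative^[n - 1] ((X ^ 2 - 1) ^ n)

theorem derivative_X_sq_sub_one_pow (n : ℕ) :
    derivative ((X ^ 2 - 1 : ℝ[X]) ^ (n + 1)) =
      C (2 * ((n : ℝ) + 1)) * (X * (X ^ 2 - 1) ^ n) := by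
  rw [derivative_pow]
  simp [C_ofNat]
  ring

/-- Differentiate `(x² - 1)^{n+1}` once, then apply Leibniz. The primed version applies Leibniz
directly to `(x² - 1) · (x² - 1)^n`; eliminating `legendreAux` between the two yields the first
recurrence. -/
theorem legendreP_succ_eq_aux (n : ℕ) :
    legendreP (n + 1) = X * legendreP n + legendreAux n := by
  unfold legendreP legendreAux
  rw [Function.iterate_succ_apply, derivative_X_sq_sub_one_pow, iterate_derivative_C_mul,
    iterate_derivative_X_mul_eq]
  have h : (n.factorial : ℝ) ≠ 0 := by positivity
  have h1 : C (1 / (2 ^ (n + 1) * ((n + 1).factorial : ℝ))) * C (2 * ((n : ℝ) + 1)) =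
      C (1 / (2 ^ n * (n.factorial : ℝ))) := by
    rw [← C_mul]; congr 1; rw [Nat.factorial_succ]; push_cast; field_simp; ring
  have h2 : C (1 / (2 ^ n * (n.factorial : ℝ))) * (n : ℝ[X]) =
      C ((n : ℝ) / (2 ^ n * (n.factorial : ℝ))) := by
    rw [← C_eq_natCast, ← C_mul]; congr 1; ring
  rw [← mul_assoc, h1, nsmul_eq_mul, ← h2]
  ring

theorem legendreP_succ_eq_aux' (n : ℕ) :
    C (2 * ((n : ℝ) + 1)) * legendreP (n + 1) =
      (X ^ 2 - 1) * derivative (legendreP n) + C (2 * ((n : ℝ) + 1)) * X * legendreP n +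
        C ((n : ℝ) + 1) * legendreAux n := by
  unfold legendreP legendreAux
  rw [pow_succ' (X ^ 2 - 1 : ℝ[X]), iterate_derivative_X_sq_sub_one_mul, derivative_C_mul,
    ← Function.iterate_succ_apply' derivative]
  have h : (n.factorial : ℝ) ≠ 0 := by positivity
  have h1 : C (2 * ((n : ℝ) + 1)) * C (1 / (2 ^ (n + 1) * ((n + 1).factorial : ℝ))) =
      C (1 / (2 ^ n * (n.factorial : ℝ))) := by
    rw [← C_mul]; congr 1; rw [Nat.factorial_succ]; push_cast; field_simp; ring
  have h2 : C ((n : ℝ) + 1) * C ((n : ℝ) / (2 ^ n * (n.factorial : ℝ))) =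
      C (1 / (2 ^ n * (n.factorial : ℝ))) * C (((n : ℝ) + 1) * n) := by
    rw [← C_mul, ← C_mul]; congr 1; ring
  rw [← mul_assoc, h1, ← mul_assoc (C ((n : ℝ) + 1)), h2]
  ring

/-- `(n + 1) P_{n+1} = (x² - 1) P_n' + (n + 1) x P_n`. -/
theorem legendreP_succ (n : ℕ) :
    C ((n : ℝ) + 1) * legendreP (n + 1) =
      (X ^ 2 - 1) * derivative (legendreP n) + C ((n : ℝ) + 1) * X * legendreP n := by
  have h1 := legendreP_succ_eq_aux n
  have h2 := legendreP_succ_eq_aux' n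
  simp only [map_mul, C_ofNat] at h2
  linear_combination h2 - C ((n : ℝ) + 1) * h1

/-- `P_{n+1}' = x P_n' + (n + 1) P_n`. -/
theorem derivative_legendreP_succ (n : ℕ) :
    derivative (legendreP (n + 1)) =
      X * derivative (legendreP n) + C ((n : ℝ) + 1) * legendreP n := by
  unfold legendreP
  rw [derivative_C_mul, derivative_C_mul, ← Function.iterate_succ_apply' derivative,
    ← Function.iterate_succ_apply' derivative, Function.iterate_succ_apply,
    derivative_X_sq_sub_one_pow, iterate_derivative_C_mul,
    iterate_derivative_X_mul_eq, Nat.add_sub_cancel]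
  have h : (n.factorial : ℝ) ≠ 0 := by positivity
  have h1 : C (1 / (2 ^ (n + 1) * ((n + 1).factorial : ℝ))) * C (2 * ((n : ℝ) + 1)) =
      C (1 / (2 ^ n * (n.factorial : ℝ))) := by
    rw [← C_mul]; congr 1; rw [Nat.factorial_succ]; push_cast; field_simp; ring
  rw [← mul_assoc, h1]
  simp
  ring

/-- The Legendre differential equation. -/
theorem legendreP_ode (n : ℕ) :
    (1 - X ^ 2) * derivative (derivative (legendreP n)) =
      2 * X * derivative (legendreP n) - C ((n : ℝ) * (n + 1)) * legendreP n := by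
  have h1 := congrArg derivative (legendreP_succ n)
  have h2 := derivative_legendreP_succ n
  simp only [derivative_mul, derivative_add, derivative_sub, derivative_C, derivative_X,
    derivative_X_pow, derivative_one] at h1
  simp [C_ofNat] at h1 h2 ⊢
  linear_combination h1 - ((n : ℝ[X]) + 1) * h2

theorem X_sq_sub_one_mul_derivative_legendreP_succ (n : ℕ) :
    (X ^ 2 - 1) * derivative (legendreP (n + 1)) =
      C ((n : ℝ) + 1) * (X * legendreP (n + 1) - legendreP n) := by
  have h1 := legendreP_succ n
  have h2 := derivative_legendreP_succ n
  linear_combination (X ^ 2 - 1) * h2 - X * h1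

theorem legendreP_three_term (n : ℕ) :
    C ((n : ℝ) + 2) * legendreP (n + 2) =
      C (2 * (n : ℝ) + 3) * (X * legendreP (n + 1)) - C ((n : ℝ) + 1) * legendreP n := by
  have h1 := legendreP_succ (n + 1)
  have h2 := X_sq_sub_one_mul_derivative_legendreP_succ n
  simp [C_ofNat] at h1 h2 ⊢
  linear_combination h1 + h2

theorem derivative_legendreP_sub (n : ℕ) :
    derivative (legendreP (n + 2)) - derivative (legendreP n) =
      C (2 * (n : ℝ) + 3) * legendreP (n + 1) := by
  have h1 := congrArg derivative (legendreP_three_term n)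
  have h2 := derivative_legendreP_succ (n + 1)
  have h : C ((n : ℝ) + 1) ≠ 0 := by
    rw [Ne, C_eq_zero]; positivity
  refine mul_left_cancel₀ h ?_
  simp [derivative_mul, C_ofNat, -mul_eq_mul_left_iff] at h1 h2 ⊢
  linear_combination (2 * (n : ℝ[X]) + 3) * h2 - h1

/-- Differentiating the three-term recurrence leaves an extra multiple of the derivative of order `k
- 1` of `P_{n+1}`; `derivative_legendreP_sub` turns it into the outer two terms, which shifts their
coefficients by `k`. -/
theorem iterate_derivative_legendreP_three_term (n k : ℕ) :
    C ((n : ℝ) + 2 - k) * derivative^[k] (legendreP (n + 2)) =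
      C (2 * (n : ℝ) + 3) * (X * derivative^[k] (legendreP (n + 1))) -
        C ((n : ℝ) + 1 + k) * derivative^[k] (legendreP n) := by
  have h1 := congrArg (derivative^[k]) (legendreP_three_term n)
  rw [iterate_derivative_C_mul, iterate_derivative_sub, iterate_derivative_C_mul,
    iterate_derivative_C_mul, iterate_derivative_X_mul_eq] at h1
  cases k with
  | zero => simpa using h1
  | succ k =>
    have h2 := congrArg (derivative^[k]) (derivative_legendreP_sub n)
    rw [iterate_derivative_C_mul, iterate_derivative_sub, ← Function.iterate_succ_apply,
      ← Function.iterate_succ_apply] at h2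
    simp [C_ofNat] at h1 h2 ⊢
    linear_combination h1 - ((k : ℝ[X]) + 1) * h2

theorem legendreP_zero : legendreP 0 = 1 := by
  simp [legendreP]

theorem legendreP_one : legendreP 1 = X := by
  rw [legendreP_succ_eq_aux, legendreP_zero]; simp [legendreAux]

theorem eval_one_legendreP (n : ℕ) : (legendreP n).eval 1 = 1 := by
  induction n with
  | zero => simp [legendreP_zero]
  | succ n ih =>
    have h := congrArg (eval 1) (legendreP_succ n)
    simp [ih] at h
    have : (n : ℝ) + 1 ≠ 0 := by positivity
    exact mul_left_cancel₀ this (by rw [h, mul_one])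

theorem eval_neg_one_legendreP (n : ℕ) : (legendreP n).eval (-1) = (-1) ^ n := by
  induction n with
  | zero => simp [legendreP_zero]
  | succ n ih =>
    have h := congrArg (eval (-1)) (legendreP_succ n)
    simp [ih] at h
    have : (n : ℝ) + 1 ≠ 0 := by positivity
    refine mul_left_cancel₀ this ?_
    rw [h]; ring

/-- By the differential equation, `n(n+1) P² + (1 - x²) P'²` has derivative `2x P'²`, so on `[-1,
1]` it is largest at the endpoints, where it equals `n(n+1)`. -/
theorem abs_eval_legendreP_le_one (n : ℕ) {x : ℝ} (hx : x ∈ Set.Icc (-1 : ℝ) 1) :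
    |(legendreP n).eval x| ≤ 1 := by
  rcases Nat.eq_zero_or_pos n with rfl | hn
  · simp [legendreP_zero]
  have hn' : (0 : ℝ) < n := by exact_mod_cast hn
  set a : ℝ := n * (n + 1) with ha
  have ha0 : 0 < a := by positivity
  -- the Sonin function
  set f : ℝ[X] := C a * legendreP n ^ 2 + (1 - X ^ 2) * derivative (legendreP n) ^ 2 with hf
  have hf' : derivative f = 2 * X * derivative (legendreP n) ^ 2 := by
    have h := legendreP_ode n
    rw [hf]
    simp only [derivative_add, derivative_mul, derivative_C, derivative_sub, derivative_one,
      derivative_pow]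
    rw [← ha] at h
    simp [C_ofNat]
    linear_combination (2 * derivative (legendreP n)) * h
  have hd : ∀ y : ℝ, deriv (fun y => f.eval y) y = 2 * y * ((derivative (legendreP n)).eval y) ^ 2 := by
    intro y
    rw [Polynomial.deriv, hf']; simp
  have hmain : f.eval x ≤ a := by
    rcases le_total 0 x with h0 | h0
    · have hm : MonotoneOn (fun y => f.eval y) (Set.Icc 0 1) := by
        refine monotoneOn_of_deriv_nonneg (convex_Icc 0 1) f.continuous.continuousOn
          f.differentiable.differentiableOn fun y hy => ?_
        rw [interior_Icc] at hy
        rw [hd]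
        have := hy.1.le
        positivity
      have := hm ⟨h0, hx.2⟩ ⟨zero_le_one, le_rfl⟩ hx.2
      simpa [hf, eval_one_legendreP] using this
    · have hm : AntitoneOn (fun y => f.eval y) (Set.Icc (-1) 0) := by
        refine antitoneOn_of_deriv_nonpos (convex_Icc (-1) 0) f.continuous.continuousOn
          f.differentiable.differentiableOn fun y hy => ?_
        rw [interior_Icc] at hy
        rw [hd]
        exact mul_nonpos_of_nonpos_of_nonneg (by linarith [hy.2]) (sq_nonneg _)
      have := hm ⟨le_rfl, by norm_num⟩ ⟨hx.1, h0⟩ hx.1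
      simpa [hf, eval_neg_one_legendreP, ← pow_mul, mul_comm n 2] using this
  have h2 : a * (legendreP n).eval x ^ 2 ≤ a * 1 := by
    have h3 : 0 ≤ (1 - x ^ 2) * ((derivative (legendreP n)).eval x) ^ 2 := by
      refine mul_nonneg ?_ (sq_nonneg _)
      nlinarith [hx.1, hx.2]
    simp [hf] at hmain
    linarith
  have h4 := le_of_mul_le_mul_left h2 ha0
  exact abs_le_one_iff_mul_self_le_one.mpr (by linarith [sq ((legendreP n).eval x)])

/-- Induction through `P_{n+2}^{(k+1)} = P_n^{(k+1)} + (2n+3) P_{n+1}^{(k)}`, closed by `n² + 2n + 3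
≤ (n+2)²`. -/
theorem abs_eval_iterate_derivative_legendreP_le (k n : ℕ) {x : ℝ}
    (hx : x ∈ Set.Icc (-1 : ℝ) 1) :
    |(derivative^[k] (legendreP n)).eval x| ≤ (n : ℝ) ^ (2 * k) := by
  induction k generalizing n with
  | zero => simpa using abs_eval_legendreP_le_one n hx
  | succ k ih =>
    induction n using Nat.strong_induction_on with
    | _ n ihn =>
      match n, ihn with
      | 0, _ => simp [legendreP_zero]
      | 1, _ =>
        rw [Function.iterate_succ_apply, legendreP_one, derivative_X]
        cases k with
        | zero => simp
        | succ k => simp [Function.iterate_succ_apply]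
      | n + 2, ihn =>
        have h := congrArg (fun p => (derivative^[k] p).eval x) (derivative_legendreP_sub n)
        simp only [iterate_derivative_C_mul, iterate_derivative_sub, ← Function.iterate_succ_apply,
          eval_sub, eval_mul, eval_C] at h
        have h1 := ihn n (by omega)
        have h2 := ih (n + 1)
        have h3 : (n : ℝ) ^ (2 * (k + 1)) ≤ (n : ℝ) ^ 2 * ((n + 2 : ℕ) : ℝ) ^ (2 * k) := by
          rw [show 2 * (k + 1) = 2 + 2 * k by ring, pow_add]
          gcongr; simp
        have h4 : ((n + 1 : ℕ) : ℝ) ^ (2 * k) ≤ ((n + 2 : ℕ) : ℝ) ^ (2 * k) := by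
          gcongr; simp
        have h5 : (0 : ℝ) ≤ ((n + 2 : ℕ) : ℝ) ^ (2 * k) := by positivity
        have h0 : (0 : ℝ) ≤ 2 * (n : ℝ) + 3 := by positivity
        calc |(derivative^[k + 1] (legendreP (n + 2))).eval x|
            = |(derivative^[k + 1] (legendreP n)).eval x +
                (2 * (n : ℝ) + 3) * (derivative^[k] (legendreP (n + 1))).eval x| := by
              congr 1; linarith
          _ ≤ |(derivative^[k + 1] (legendreP n)).eval x| +
                (2 * (n : ℝ) + 3) * |(derivative^[k] (legendreP (n + 1))).eval x| := by
              refine (abs_add_le _ _).trans_eq ?_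
              rw [abs_mul, abs_of_nonneg h0]
          _ ≤ (n : ℝ) ^ 2 * ((n + 2 : ℕ) : ℝ) ^ (2 * k) +
                (2 * (n : ℝ) + 3) * ((n + 2 : ℕ) : ℝ) ^ (2 * k) := by
              gcongr
              · exact h1.trans h3
              · exact h2.trans h4
          _ ≤ ((n + 2 : ℕ) : ℝ) ^ (2 * (k + 1)) := by
              rw [show 2 * (k + 1) = 2 + 2 * k by ring, pow_add, ← add_mul]
              gcongr
              push_cast
              nlinarith [Nat.cast_nonneg (α := ℝ) n]

end Legendre
end DirectionalWavelet

namespace DirectionalWavelet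
-- Calculus of discrete symbols, uniform in a parameter.
section Symbols
open Asymptotics Filter

/-- The filter on `ℕ × ℕ` along which the second coordinate tends to infinity, uniformly in the
first one. -/
def sndAtTop : Filter (ℕ × ℕ) := comap Prod.snd atTop

theorem eventually_sndAtTop {p : ℕ × ℕ → Prop} (n₀ : ℕ) (h : ∀ N n, n₀ ≤ n → p (N, n)) :
    ∀ᶠ x in sndAtTop, p x :=
  ((eventually_ge_atTop n₀).comap Prod.snd).mono fun x hx => h x.1 x.2 hx

theorem eventually_sndAtTop_iff {p : ℕ × ℕ → Prop} :
    (∀ᶠ x in sndAtTop, p x) ↔ ∃ n₀, ∀ N n, n₀ ≤ n → p (N, n) := by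
  rw [sndAtTop, eventually_comap, eventually_atTop]
  exact exists_congr fun n₀ => ⟨fun h N n hn => h n hn (N, n) rfl,
    fun h b hb a ha => by subst ha; exact h a.1 a.2 hb⟩

/-- Forward difference in the second variable. -/
def sndDiff (f : ℕ × ℕ → ℝ) (x : ℕ × ℕ) : ℝ := f (x.1, x.2 + 1) - f x

/-- `f` is a discrete symbol of order `μ` in the second variable, uniformly in the first one, with
control of `r` differences. -/
def IsSymbol : ℕ → ℤ → (ℕ × ℕ → ℝ) → Prop
  | 0, μ, f => f =O[sndAtTop] fun x => (x.2 : ℝ) ^ μ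
  | r + 1, μ, f => (f =O[sndAtTop] fun x => (x.2 : ℝ) ^ μ) ∧ IsSymbol r (μ - 1) (sndDiff f)

theorem tendsto_succ_sndAtTop :
    Tendsto (fun x : ℕ × ℕ => (x.1, x.2 + 1)) sndAtTop sndAtTop :=
  tendsto_comap_iff.2 ((tendsto_add_atTop_nat 1).comp tendsto_comap)

theorem tendsto_pred_sndAtTop :
    Tendsto (fun x : ℕ × ℕ => (x.1, x.2 - 1)) sndAtTop sndAtTop :=
  tendsto_comap_iff.2 ((tendsto_sub_atTop_nat 1).comp tendsto_comap)

theorem eventually_snd_pos : ∀ᶠ x : ℕ × ℕ in sndAtTop, (0 : ℝ) < x.2 :=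
  eventually_sndAtTop 1 fun _ n hn => by exact_mod_cast hn

theorem isBigO_zpow_of_isTheta {l : Filter (ℕ × ℕ)} {u v : ℕ × ℕ → ℝ} (h : u =Θ[l] v) (μ : ℤ) :
    (fun x => u x ^ μ) =O[l] fun x => v x ^ μ :=
  (h.zpow μ).1

theorem isTheta_succ :
    (fun x : ℕ × ℕ => ((x.2 + 1 : ℕ) : ℝ)) =Θ[sndAtTop] fun x => (x.2 : ℝ) := by
  constructor
  · refine IsBigO.of_bound 2 (eventually_sndAtTop 1 fun N n hn => ?_)
    have : (1 : ℝ) ≤ n := by exact_mod_cast hn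
    simp only [Real.norm_natCast]
    push_cast
    linarith
  · refine IsBigO.of_bound 1 (eventually_sndAtTop 1 fun N n hn => ?_)
    simp only [Real.norm_natCast]
    simp

theorem isTheta_pred :
    (fun x : ℕ × ℕ => ((x.2 - 1 : ℕ) : ℝ)) =Θ[sndAtTop] fun x => (x.2 : ℝ) := by
  constructor
  · refine IsBigO.of_bound 1 (eventually_sndAtTop 1 fun N n hn => ?_)
    simp
  · refine IsBigO.of_bound 2 (eventually_sndAtTop 2 fun N n hn => ?_)
    have : (2 : ℝ) ≤ n := by exact_mod_cast hn
    simp only [Real.norm_natCast]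
    push_cast [Nat.cast_sub (by omega : 1 ≤ n)]
    linarith

theorem isBigO_zpow_of_le {μ ν : ℤ} (h : μ ≤ ν) :
    (fun x : ℕ × ℕ => (x.2 : ℝ) ^ μ) =O[sndAtTop] fun x => (x.2 : ℝ) ^ ν := by
  refine IsBigO.of_bound 1 (eventually_sndAtTop 1 fun N n hn => ?_)
  have : (1 : ℝ) ≤ n := by exact_mod_cast hn
  rw [one_mul, Real.norm_of_nonneg (by positivity), Real.norm_of_nonneg (by positivity)]
  exact zpow_le_zpow_right₀ this h

theorem zpow_add_eventuallyEq (μ ν : ℤ) :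
    (fun x : ℕ × ℕ => (x.2 : ℝ) ^ μ * (x.2 : ℝ) ^ ν) =ᶠ[sndAtTop]
      fun x => (x.2 : ℝ) ^ (μ + ν) := by
  filter_upwards [eventually_snd_pos] with x hx
  rw [zpow_add₀ hx.ne']

namespace IsSymbol

variable {r s : ℕ} {μ ν : ℤ} {f g : ℕ × ℕ → ℝ}

theorem isBigO (h : IsSymbol r μ f) : f =O[sndAtTop] fun x => (x.2 : ℝ) ^ μ := by
  cases r with
  | zero => exact h
  | succ r => exact h.1

theorem of_succ (h : IsSymbol (r + 1) μ f) : IsSymbol r μ f := by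
  induction r generalizing μ f with
  | zero => exact h.1
  | succ r ih => exact ⟨h.1, ih h.2⟩

theorem of_le (h : IsSymbol r μ f) (hs : s ≤ r) : IsSymbol s μ f := by
  induction hs with
  | refl => exact h
  | step _ ih => exact ih h.of_succ

theorem congr' (h : IsSymbol r μ f) (hfg : f =ᶠ[sndAtTop] g) : IsSymbol r μ g := by
  induction r generalizing μ f g with
  | zero => exact h.congr' hfg EventuallyEq.rfl
  | succ r ih =>
    refine ⟨h.1.congr' hfg EventuallyEq.rfl, ih h.2 ?_⟩
    filter_upwards [hfg, tendsto_succ_sndAtTop.eventually hfg] with x h1 h2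
    simp only [sndDiff]
    rw [h1, h2]

theorem zero : IsSymbol r μ fun _ => 0 := by
  induction r generalizing μ with
  | zero => exact isBigO_zero _ _
  | succ r ih =>
    refine ⟨isBigO_zero _ _, ?_⟩
    have : sndDiff (fun _ => 0) = fun _ => 0 := by ext; simp [sndDiff]
    rw [this]
    exact ih

theorem add (hf : IsSymbol r μ f) (hg : IsSymbol r μ g) : IsSymbol r μ fun x => f x + g x := by
  induction r generalizing μ f g with
  | zero => exact IsBigO.add hf hg
  | succ r ih =>
    refine ⟨hf.1.add hg.1, ?_⟩
    have : sndDiff (fun x => f x + g x) = fun x => sndDiff f x + sndDiff g x := by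
      ext; simp only [sndDiff]; ring
    rw [this]
    exact ih hf.2 hg.2

theorem const_mul (hf : IsSymbol r μ f) (c : ℝ) : IsSymbol r μ fun x => c * f x := by
  induction r generalizing μ f with
  | zero => exact hf.const_mul_left c
  | succ r ih =>
    refine ⟨hf.1.const_mul_left c, ?_⟩
    have : sndDiff (fun x => c * f x) = fun x => c * sndDiff f x := by
      ext; simp only [sndDiff]; ring
    rw [this]
    exact ih hf.2

theorem of_order_le (hf : IsSymbol r μ f) (h : μ ≤ ν) : IsSymbol r ν f := by
  induction r generalizing μ ν f with
  | zero => exact IsBigO.trans hf (isBigO_zpow_of_le h)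
  | succ r ih => exact ⟨hf.1.trans (isBigO_zpow_of_le h), ih hf.2 (by omega)⟩

theorem const (c : ℝ) : IsSymbol r 0 fun _ => c := by
  have key : (fun _ => c) =O[sndAtTop] fun x => (x.2 : ℝ) ^ (0 : ℤ) := by
    simp only [zpow_zero]
    exact isBigO_const_const c one_ne_zero sndAtTop
  cases r with
  | zero => exact key
  | succ r =>
    refine ⟨key, ?_⟩
    have : sndDiff (fun _ => c) = fun _ => 0 := by ext; simp [sndDiff]
    rw [this]
    exact zero

theorem snd : IsSymbol r 1 fun x => (x.2 : ℝ) := by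
  cases r with
  | zero => simpa [IsSymbol] using isBigO_refl _ sndAtTop
  | succ r =>
    refine ⟨by simpa using isBigO_refl _ sndAtTop, ?_⟩
    have : sndDiff (fun x => (x.2 : ℝ)) = fun _ => 1 := by ext; simp [sndDiff]
    rw [this]
    exact const 1

theorem comp_succ (hf : IsSymbol r μ f) : IsSymbol r μ fun x => f (x.1, x.2 + 1) := by
  have key : ∀ {f : ℕ × ℕ → ℝ} {μ : ℤ}, (f =O[sndAtTop] fun x => (x.2 : ℝ) ^ μ) →
      (fun x : ℕ × ℕ => f (x.1, x.2 + 1)) =O[sndAtTop] fun x => (x.2 : ℝ) ^ μ := fun h =>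
    (h.comp_tendsto tendsto_succ_sndAtTop).trans (isBigO_zpow_of_isTheta isTheta_succ _)
  induction r generalizing μ f with
  | zero => exact key hf
  | succ r ih => exact ⟨key hf.1, ih hf.2⟩

/-- Truncation of `n - 1` at `n = 0` is harmless, since the filter sees only large `n`. -/
theorem comp_pred (hf : IsSymbol r μ f) : IsSymbol r μ fun x => f (x.1, x.2 - 1) := by
  have key : ∀ {f : ℕ × ℕ → ℝ} {μ : ℤ}, (f =O[sndAtTop] fun x => (x.2 : ℝ) ^ μ) →
      (fun x : ℕ × ℕ => f (x.1, x.2 - 1)) =O[sndAtTop] fun x => (x.2 : ℝ) ^ μ := fun h =>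
    (h.comp_tendsto tendsto_pred_sndAtTop).trans (isBigO_zpow_of_isTheta isTheta_pred _)
  induction r generalizing μ f with
  | zero => exact key hf
  | succ r ih =>
    refine ⟨key hf.1, (ih hf.2).congr' (eventually_sndAtTop 1 fun N n hn => ?_)⟩
    simp only [sndDiff]
    rw [Nat.sub_add_cancel hn, Nat.add_sub_cancel]

theorem mul (hf : IsSymbol r μ f) (hg : IsSymbol r ν g) :
    IsSymbol r (μ + ν) fun x => f x * g x := by
  have key : (fun x => f x * g x) =O[sndAtTop] fun x => (x.2 : ℝ) ^ (μ + ν) :=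
    (hf.isBigO.mul hg.isBigO).trans_eventuallyEq (zpow_add_eventuallyEq μ ν)
  induction r generalizing μ ν f g with
  | zero => exact key
  | succ r ih =>
    refine ⟨key, ?_⟩
    have : sndDiff (fun x => f x * g x) =
        fun x => sndDiff f x * g (x.1, x.2 + 1) + f x * sndDiff g x := by
      ext; simp only [sndDiff]; ring
    rw [this]
    have hg' := hg.of_succ.comp_succ
    have hf' := hf.of_succ
    refine add ?_ ?_
    · rw [show μ + ν - 1 = (μ - 1) + ν by ring]
      exact ih hf.2 hg' ((hf.2.isBigO.mul hg'.isBigO).trans_eventuallyEq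
        (zpow_add_eventuallyEq _ _))
    · rw [show μ + ν - 1 = μ + (ν - 1) by ring]
      exact ih hf' hg.2 ((hf'.isBigO.mul hg.2.isBigO).trans_eventuallyEq
        (zpow_add_eventuallyEq _ _))

theorem eventually_ne_zero (h : (fun x : ℕ × ℕ => (x.2 : ℝ) ^ μ) =O[sndAtTop] f) :
    ∀ᶠ x in sndAtTop, f x ≠ 0 := by
  filter_upwards [h.eq_zero_imp, eventually_snd_pos] with x hx hp h0
  exact (zpow_pos hp μ).ne' (hx h0)

/-- Uses `Δ(1/f) = -Δf / (f(n) f(n+1))`; the lower bound on `f` controls the denominators. -/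
theorem inv (hf : IsSymbol r μ f) (h : (fun x : ℕ × ℕ => (x.2 : ℝ) ^ μ) =O[sndAtTop] f) :
    IsSymbol r (-μ) fun x => (f x)⁻¹ := by
  have key : (fun x => (f x)⁻¹) =O[sndAtTop] fun x => (x.2 : ℝ) ^ (-μ) := by
    have := h.inv_rev (by
      filter_upwards [eventually_snd_pos] with x hx h0
      exact absurd h0 (zpow_pos hx μ).ne')
    simpa only [zpow_neg] using this
  induction r with
  | zero => exact key
  | succ r ih =>
    refine ⟨key, ?_⟩
    have h1 := ih hf.of_succ
    have h2 := ((hf.2.mul (h1.mul h1.comp_succ)).const_mul (-1))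
    rw [show μ - 1 + (-μ + -μ) = -μ - 1 by ring] at h2
    refine h2.congr' ?_
    have h0 := eventually_ne_zero h
    filter_upwards [h0, tendsto_succ_sndAtTop.eventually h0] with x hx hx'
    simp only [sndDiff]
    field_simp
    ring

/-- Uses `Δ√f = Δf / (√f(n) + √f(n+1))`, with the lower bound making the denominator invertible. -/
theorem sqrt (hf : IsSymbol r (2 * μ) f)
    (h : (fun x : ℕ × ℕ => (x.2 : ℝ) ^ (2 * μ)) =O[sndAtTop] f) (h0 : ∀ᶠ x in sndAtTop, 0 ≤ f x) :
    IsSymbol r μ fun x => √(f x) := by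
  have hz : ∀ x : ℕ × ℕ, √((x.2 : ℝ) ^ (2 * μ)) = (x.2 : ℝ) ^ μ := fun x => by
    rw [mul_comm, zpow_mul, show ((x.2 : ℝ) ^ μ) ^ (2 : ℤ) = ((x.2 : ℝ) ^ μ) ^ 2 from rfl,
      Real.sqrt_sq (by positivity)]
  have key : (fun x => √(f x)) =O[sndAtTop] fun x => (x.2 : ℝ) ^ μ := by
    simpa only [hz] using hf.isBigO.sqrt (Eventually.of_forall fun x =>
      zpow_nonneg (Nat.cast_nonneg x.2) _)
  have key' : (fun x : ℕ × ℕ => (x.2 : ℝ) ^ μ) =O[sndAtTop] fun x => √(f x) := by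
    simpa only [hz] using h.sqrt h0
  induction r with
  | zero => exact key
  | succ r ih =>
    refine ⟨key, ?_⟩
    have h1 := ih hf.of_succ
    have h2 := (h1.add h1.comp_succ).inv (key'.trans (IsBigO.of_bound 1
      (Eventually.of_forall fun x => by
        rw [Real.norm_of_nonneg (by positivity), Real.norm_of_nonneg (by positivity), one_mul]
        linarith [Real.sqrt_nonneg (f (x.1, x.2 + 1))])))
    have h3 := hf.2.mul h2
    rw [show 2 * μ - 1 + -μ = μ - 1 by ring] at h3
    refine h3.congr' ?_
    have hne := eventually_ne_zero key'
    filter_upwards [hne, h0, tendsto_succ_sndAtTop.eventually h0] with x hx h4 h5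
    have hpos : 0 < √(f x) := lt_of_le_of_ne (Real.sqrt_nonneg _) (Ne.symm hx)
    have hs := Real.sqrt_nonneg (f (x.1, x.2 + 1))
    have e1 := Real.sq_sqrt h4
    have e2 := Real.sq_sqrt h5
    simp only [sndDiff]
    rw [← div_eq_mul_inv, div_eq_iff (by positivity)]
    linear_combination e1 - e2

/-- A translate `n + a` of the identity. -/
theorem snd_add (a : ℝ) : IsSymbol r 1 fun x => (x.2 : ℝ) + a :=
  snd.add ((const a).of_order_le zero_le_one)

end IsSymbol

theorem zpow_isBigO_snd_add (a : ℝ) :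
    (fun x : ℕ × ℕ => (x.2 : ℝ) ^ (1 : ℤ)) =O[sndAtTop] fun x => (x.2 : ℝ) + a := by
  refine IsBigO.of_bound 2 (eventually_sndAtTop (⌈2 * |a|⌉₊) fun N n hn => ?_)
  have h1 : 2 * |a| ≤ n := (Nat.le_ceil _).trans (by exact_mod_cast hn)
  have h2 := neg_abs_le a
  have h3 := abs_nonneg a
  rw [zpow_one, Real.norm_of_nonneg (by positivity), Real.norm_of_nonneg (by linarith)]
  linarith

theorem isSymbol_prod_snd_add {ι : Type*} (s : Finset ι) (a : ι → ℝ) (r : ℕ) :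
    IsSymbol r s.card fun x => ∏ i ∈ s, ((x.2 : ℝ) + a i) := by
  classical
  induction s using Finset.induction_on with
  | empty => simpa using IsSymbol.const 1
  | insert i s hi ih =>
    simp only [Finset.prod_insert hi, Finset.card_insert_of_notMem hi]
    have := (IsSymbol.snd_add (a i)).mul ih
    rwa [show (1 : ℤ) + s.card = ((s.card + 1 : ℕ) : ℤ) by push_cast; ring] at this

theorem zpow_isBigO_prod_snd_add {ι : Type*} (s : Finset ι) (a : ι → ℝ) :
    (fun x : ℕ × ℕ => (x.2 : ℝ) ^ (s.card : ℤ)) =O[sndAtTop]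
      fun x => ∏ i ∈ s, ((x.2 : ℝ) + a i) := by
  classical
  induction s using Finset.induction_on with
  | empty => simpa using isBigO_refl (fun _ : ℕ × ℕ => (1 : ℝ)) sndAtTop
  | insert i s hi ih =>
    simp only [Finset.prod_insert hi, Finset.card_insert_of_notMem hi]
    have := (zpow_isBigO_snd_add (a i)).mul ih
    refine (EventuallyEq.symm ?_).trans_isBigO this
    rw [show ((s.card + 1 : ℕ) : ℤ) = 1 + s.card by push_cast; ring]
    exact zpow_add_eventuallyEq _ _

/-- A nonzero sample forces `n ≤ A (N + 1)`, so powers of `1 / (N + 1)` are bounded by powers of `A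
/ n`. -/
theorem isBigO_sample (s : ℕ) (f : ℕ → ℝ → ℝ) (C A : ℝ) (hA : 0 ≤ A)
    (hb : ∀ N t, |f N t| ≤ C * ((N : ℝ) + 1)⁻¹ ^ s) (h0 : ∀ N t, A < t → f N t = 0) :
    (fun x : ℕ × ℕ => f x.1 ((x.2 : ℝ) / ((x.1 : ℝ) + 1))) =O[sndAtTop]
      fun x => (x.2 : ℝ) ^ (-(s : ℤ)) := by
  have hC : 0 ≤ C := by
    have := (abs_nonneg _).trans (hb 0 0)
    simpa using this
  refine IsBigO.of_bound (C * A ^ s) (eventually_sndAtTop 1 fun N n hn => ?_)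
  have hn' : (0 : ℝ) < n := by exact_mod_cast hn
  have hN : (0 : ℝ) < (N : ℝ) + 1 := by positivity
  dsimp only
  rcases lt_or_ge A ((n : ℝ) / ((N : ℝ) + 1)) with h | h
  · rw [h0 N _ h, norm_zero]; positivity
  · rw [div_le_iff₀ hN] at h
    rw [Real.norm_eq_abs, Real.norm_of_nonneg (by positivity), zpow_neg, zpow_natCast, mul_assoc,
      ← inv_pow, ← mul_pow]
    refine (hb N _).trans ?_
    gcongr
    rw [inv_eq_one_div, div_le_iff₀ hN, mul_assoc, mul_comm _ ((N : ℝ) + 1), ← mul_assoc,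
      ← div_eq_mul_inv, le_div_iff₀ hn', one_mul]
    exact h

/-- Samples `f_N (n / (N + 1))` of a family of `C^r` functions with derivatives
`O((N + 1)^(-s))`. -/
theorem isSymbol_sample (r s : ℕ) (f : ℕ → ℝ → ℝ) (C A : ℝ) (hA : 0 ≤ A)
    (hf : ∀ N, ContDiff ℝ r (f N))
    (hb : ∀ N, ∀ j ≤ r, ∀ t, |iteratedDeriv j (f N) t| ≤ C * ((N : ℝ) + 1)⁻¹ ^ s)
    (h0 : ∀ N t, A < t → f N t = 0) :
    IsSymbol r (-(s : ℤ)) fun x => f x.1 ((x.2 : ℝ) / ((x.1 : ℝ) + 1)) := by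
  have key := isBigO_sample s f C A hA (fun N t => by simpa using hb N 0 (Nat.zero_le _) t) h0
  induction r generalizing s f with
  | zero => exact key
  | succ r ih =>
    refine ⟨key, ?_⟩
    -- The difference samples another family, `f(t + h) - f(t)` with `h = 1 / (N + 1)`. The mean
    -- value theorem gains one factor `h` at the cost of one derivative, so the induction must allow
    -- functions depending on `N`.
    have e : sndDiff (fun x => f x.1 ((x.2 : ℝ) / ((x.1 : ℝ) + 1))) = fun x =>
        (fun (N : ℕ) t => f N (t + 1 / ((N : ℝ) + 1)) - f N t) x.1
          ((x.2 : ℝ) / ((x.1 : ℝ) + 1)) := by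
      ext x; simp [sndDiff, add_div]
    have hr : ∀ N, ContDiff ℝ r (f N) := fun N =>
      (hf N).of_le (by exact_mod_cast Nat.le_succ r)
    have hb1 : ∀ N, ∀ j ≤ r, ∀ t, |iteratedDeriv j
        (fun t => f N (t + 1 / ((N : ℝ) + 1)) - f N t) t| ≤ C * ((N : ℝ) + 1)⁻¹ ^ (s + 1) := by
      intro N j hj t
      have hjr : ContDiff ℝ j (f N) := (hr N).of_le (by exact_mod_cast hj)
      have hjs : ContDiff ℝ j fun t => f N (t + 1 / ((N : ℝ) + 1)) :=
        hjr.comp (contDiff_id.add contDiff_const)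
      rw [iteratedDeriv_fun_sub hjs.contDiffAt hjr.contDiffAt, iteratedDeriv_comp_add_const]
      have hd : Differentiable ℝ (iteratedDeriv j (f N)) :=
        (hf N).differentiable_iteratedDeriv j (by exact_mod_cast Nat.lt_succ_of_le hj)
      have := Convex.norm_image_sub_le_of_norm_deriv_le (f := iteratedDeriv j (f N))
        (s := Set.univ) (C := C * ((N : ℝ) + 1)⁻¹ ^ s) (fun y _ => hd y) (fun y _ => by
          rw [← iteratedDeriv_succ]; exact hb N (j + 1) (by omega) y) convex_univ
        (Set.mem_univ t) (Set.mem_univ (t + 1 / ((N : ℝ) + 1)))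
      rw [add_sub_cancel_left, Real.norm_eq_abs, one_div, Real.norm_of_nonneg (by positivity)]
        at this
      rw [pow_succ, ← mul_assoc, one_div]
      exact this
    have h01 : ∀ N t, A < t → (fun t => f N (t + 1 / ((N : ℝ) + 1)) - f N t) t = 0 := by
      intro N t ht
      dsimp only
      have : (0 : ℝ) < 1 / ((N : ℝ) + 1) := by positivity
      rw [h0 N t ht, h0 N _ (by linarith), sub_zero]
    rw [e, show -(s : ℤ) - 1 = -((s + 1 : ℕ) : ℤ) by push_cast; ring]
    refine ih (s + 1) (fun (N : ℕ) t => f N (t + 1 / ((N : ℝ) + 1)) - f N t) (fun N =>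
      ((hr N).comp (contDiff_id.add contDiff_const)).sub (hr N)) hb1 h01 (isBigO_sample _ _ C A hA
        (fun N t => by simpa using hb1 N 0 (Nat.zero_le _) t) h01)

end Symbols
end DirectionalWavelet

namespace DirectionalWavelet
-- Window functions as symbols of order zero.
section Window
open Filter Topology

theorem IsWindow.eq_zero {r : ℕ} {κ : ℝ → ℝ} (h : IsWindow r κ) {t : ℝ} (ht : 0 ≤ t)
    (ht' : t ∉ Set.Icc (1 / 2 : ℝ) 2) : κ t = 0 := by
  by_contra hne
  exact ht' (h.support_subset (subset_closure ⟨hne, ht⟩))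

/-- The extension of a window function by zero to the negative half-line. -/
noncomputable def zeroExtend (κ : ℝ → ℝ) (t : ℝ) : ℝ := if 0 ≤ t then κ t else 0

theorem IsWindow.zeroExtend_eq_zero {r : ℕ} {κ : ℝ → ℝ} (h : IsWindow r κ) {t : ℝ}
    (ht : t ∉ Set.Icc (1 / 2 : ℝ) 2) : zeroExtend κ t = 0 := by
  unfold zeroExtend
  split_ifs with h0
  · exact h.eq_zero h0 ht
  · rfl

/-- No smoothness is lost at `0`, because `κ` already vanishes on `[0, 1/2)`. -/
theorem IsWindow.contDiff_zeroExtend {r : ℕ} {κ : ℝ → ℝ} (h : IsWindow r κ) :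
    ContDiff ℝ r (zeroExtend κ) := by
  rw [contDiff_iff_contDiffAt]
  intro t
  rcases lt_or_ge 0 t with ht | ht
  · refine ((h.contDiffOn t ht.le).contDiffAt (Ici_mem_nhds ht)).congr_of_eventuallyEq ?_
    filter_upwards [lt_mem_nhds ht] with s hs
    simp [zeroExtend, hs.le]
  · refine (contDiffAt_const (c := (0 : ℝ))).congr_of_eventuallyEq ?_
    filter_upwards [gt_mem_nhds (show t < 1 / 2 by linarith)] with s hs
    exact h.zeroExtend_eq_zero fun hm => absurd hm.1 (not_le.2 hs)

theorem IsWindow.isSymbol {r : ℕ} {κ : ℝ → ℝ} (h : IsWindow r κ) :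
    IsSymbol r 0 fun x => κ ((x.2 : ℝ) / ((x.1 : ℝ) + 1)) := by
  have hcs : HasCompactSupport (zeroExtend κ) :=
    HasCompactSupport.intro isCompact_Icc fun t ht => h.zeroExtend_eq_zero ht
  have hb : ∀ j ≤ r, ∃ C, ∀ t, |iteratedDeriv j (zeroExtend κ) t| ≤ C := by
    intro j hj
    have hc : Continuous (iteratedFDeriv ℝ j (zeroExtend κ)) :=
      h.contDiff_zeroExtend.continuous_iteratedFDeriv (by exact_mod_cast hj)
    obtain ⟨C, hC⟩ := hc.bounded_above_of_compact_support (hcs.iteratedFDeriv j)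
    refine ⟨C, fun t => ?_⟩
    have := hC t
    rwa [norm_iteratedFDeriv_eq_norm_iteratedDeriv] at this
  choose! C hC using hb
  have hC0 : ∀ j ∈ Finset.range (r + 1), 0 ≤ C j := fun j hj =>
    (abs_nonneg _).trans (hC j (Nat.lt_succ_iff.1 (Finset.mem_range.1 hj)) 0)
  have := isSymbol_sample r 0 (fun _ => zeroExtend κ) (∑ j ∈ Finset.range (r + 1), C j) 2
    zero_le_two (fun _ => h.contDiff_zeroExtend) (fun _ j hj t => by
      rw [pow_zero, mul_one]
      exact (hC j hj t).trans (Finset.single_le_sum hC0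
        (Finset.mem_range.2 (Nat.lt_succ_of_le hj))))
    (fun _ t ht => h.zeroExtend_eq_zero fun hm => absurd hm.2 (not_le.2 ht))
  have e : (fun x : ℕ × ℕ => κ ((x.2 : ℝ) / ((x.1 : ℝ) + 1))) =
      fun x => zeroExtend κ ((x.2 : ℝ) / ((x.1 : ℝ) + 1)) := by
    ext x
    have : (0 : ℝ) ≤ (x.2 : ℝ) / ((x.1 : ℝ) + 1) := by positivity
    simp [zeroExtend, this]
  rw [e]
  exact_mod_cast this

end Window

/-! ### Summation by parts against derivatives of Legendre polynomials. -/

section Step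
open Polynomial

/-- The operator on coefficient sequences that corresponds to multiplication of
`∑ n, (2 * n + 1) * g n * (d / dx) ^ k P_n` by `1 - x`. -/
noncomputable def legendreStep (k : ℕ) (g : ℕ × ℕ → ℝ) (x : ℕ × ℕ) : ℝ :=
  g x - (((x.2 : ℝ) - k) * g (x.1, x.2 - 1) + ((x.2 : ℝ) + 1 + k) * g (x.1, x.2 + 1)) /
    (2 * (x.2 : ℝ) + 1)

/-- Splitting the coefficients around `n + 1/2` gives `-½ Δ²g(n-1) - (2k+1)/4 · (Δg(n) + Δg(n-1)) /
(n + 1/2)`. Both terms have order `μ - 2`: one through a second difference, the other through a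
first difference and a division by `n`. -/
theorem IsSymbol.legendreStep {r : ℕ} {μ : ℤ} {g : ℕ × ℕ → ℝ} (k : ℕ)
    (hg : IsSymbol (r + 2) μ g) : IsSymbol r (μ - 2) (legendreStep k g) := by
  have h1 : IsSymbol r (μ - 1) (sndDiff g) := hg.2.of_succ
  have h2 : IsSymbol r (μ - 2) (sndDiff (sndDiff g)) := by
    rw [show μ - 2 = μ - 1 - 1 by ring]; exact hg.2.2
  have h3 : IsSymbol r (-1) fun x : ℕ × ℕ => ((x.2 : ℝ) + 1 / 2)⁻¹ :=
    (IsSymbol.snd_add (1 / 2)).inv (zpow_isBigO_snd_add _)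
  have h4 := h3.mul (h1.add h1.comp_pred)
  rw [show -1 + (μ - 1) = μ - 2 by ring] at h4
  refine ((h2.comp_pred.const_mul (-1 / 2)).add
    (h4.const_mul (-(2 * (k : ℝ) + 1) / 4))).congr' (eventually_sndAtTop 1 fun N n hn => ?_)
  obtain ⟨n, rfl⟩ := Nat.exists_eq_add_of_le' hn
  simp only [DirectionalWavelet.legendreStep, sndDiff, Nat.add_sub_cancel]
  have hp : ((n + 1 : ℕ) : ℝ) + 1 / 2 ≠ 0 := by positivity
  have hp' : 2 * ((n + 1 : ℕ) : ℝ) + 1 ≠ 0 := by positivity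
  field_simp
  ring

theorem IsSymbol.iterate_legendreStep {r m : ℕ} {μ : ℤ} {g : ℕ × ℕ → ℝ} (k : ℕ)
    (hg : IsSymbol (r + 2 * m) μ g) :
    IsSymbol r (μ - 2 * m) ((DirectionalWavelet.legendreStep k)^[m] g) := by
  induction m generalizing μ g with
  | zero => simpa using hg
  | succ m ih =>
    rw [Function.iterate_succ_apply,
      show μ - 2 * ((m + 1 : ℕ) : ℤ) = μ - 2 - 2 * m by push_cast; ring]
    exact ih (IsSymbol.legendreStep k hg)

theorem iterate_legendreStep_eq_zero_of_ge {k m M N : ℕ} {g : ℕ × ℕ → ℝ}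
    (hg : ∀ n, M ≤ n → g (N, n) = 0) {n : ℕ} (hn : M + m ≤ n) :
    (legendreStep k)^[m] g (N, n) = 0 := by
  induction m generalizing M g with
  | zero => exact hg n hn
  | succ m ih =>
    rw [Function.iterate_succ_apply]
    refine ih (M := M + 1) (fun n hn => ?_) (by omega)
    simp only [legendreStep]
    rw [hg n (by omega), hg (n - 1) (by omega), hg (n + 1) (by omega)]
    simp

theorem iterate_legendreStep_eq_zero_of_lt {k m a N : ℕ} {g : ℕ × ℕ → ℝ}
    (hg : ∀ n, n < a → g (N, n) = 0) {n : ℕ} (hn : n + m < a) :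
    (legendreStep k)^[m] g (N, n) = 0 := by
  induction m generalizing a g with
  | zero => exact hg n hn
  | succ m ih =>
    rw [Function.iterate_succ_apply]
    refine ih (a := a - 1) (fun n hn => ?_) (by omega)
    simp only [legendreStep]
    rw [hg n (by omega), hg (n - 1) (by omega), hg (n + 1) (by omega)]
    simp

/-- The differentiated three-term recurrence makes the sum telescope, leaving only boundary terms at
`M`. These vanish once `g` does. -/
theorem sum_legendreStep_sub (k N M : ℕ) (g : ℕ × ℕ → ℝ) (x : ℝ) :
    ∑ n ∈ Finset.range (M + 1), (2 * (n : ℝ) + 1) * ((1 - x) * g (N, n) - legendreStep k g (N, n)) *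
        (derivative^[k] (legendreP n)).eval x =
      ((M : ℝ) + 1 + k) * g (N, M + 1) * (derivative^[k] (legendreP M)).eval x -
        ((M : ℝ) + 1 - k) * g (N, M) * (derivative^[k] (legendreP (M + 1))).eval x := by
  induction M with
  | zero =>
    rw [Finset.sum_range_one]
    simp only [legendreStep]
    -- At `n = 0` the truncated index `n - 1` contributes nothing: its coefficient `-k` is zero for
    -- `k = 0`, and the `k`-th derivative of `P_0` is zero otherwise.
    match k with
    | 0 => simp [legendreP_zero, legendreP_one]; ring
    | 1 => simp [legendreP_zero]
    | k + 2 => simp [legendreP_zero, legendreP_one, Function.iterate_succ_apply]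
  | succ M ih =>
    rw [Finset.sum_range_succ, ih]
    have h := congrArg (eval x) (iterate_derivative_legendreP_three_term M k)
    simp only [eval_mul, eval_sub, eval_C, eval_X] at h
    simp only [legendreStep, Nat.add_sub_cancel]
    have hp : 2 * ((M + 1 : ℕ) : ℝ) + 1 ≠ 0 := by positivity
    field_simp
    push_cast
    rw [show M + 1 + 1 = M + 2 by ring]
    linear_combination g (N, M + 1) * h

theorem sum_iterate_legendreStep (k N M m : ℕ) (g : ℕ × ℕ → ℝ) (x : ℝ)
    (hg : ∀ n, M ≤ n → g (N, n) = 0) :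
    ∑ n ∈ Finset.range (M + m), (2 * (n : ℝ) + 1) * (legendreStep k)^[m] g (N, n) *
        (derivative^[k] (legendreP n)).eval x =
      (1 - x) ^ m * ∑ n ∈ Finset.range M, (2 * (n : ℝ) + 1) * g (N, n) *
        (derivative^[k] (legendreP n)).eval x := by
  induction m generalizing M g with
  | zero => simp
  | succ m ih =>
    have h1 := ih (M + 1) (legendreStep k g) fun n hn =>
      iterate_legendreStep_eq_zero_of_ge (m := 1) hg hn
    rw [Function.iterate_succ_apply, show M + (m + 1) = M + 1 + m by ring, h1, pow_succ, mul_assoc]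
    congr 1
    have h2 := sum_legendreStep_sub k N M g x
    rw [hg M le_rfl, hg (M + 1) (Nat.le_succ M)] at h2
    have h3 : ∑ n ∈ Finset.range (M + 1), (2 * (n : ℝ) + 1) * g (N, n) *
        (derivative^[k] (legendreP n)).eval x = ∑ n ∈ Finset.range M, (2 * (n : ℝ) + 1) * g (N, n) *
        (derivative^[k] (legendreP n)).eval x := by
      rw [Finset.sum_range_succ, hg M le_rfl]; simp
    rw [← h3, Finset.mul_sum, ← sub_eq_zero, ← Finset.sum_sub_distrib, ← neg_eq_zero,
      ← Finset.sum_neg_distrib]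
    rw [mul_zero, zero_mul, mul_zero, zero_mul, sub_zero] at h2
    rw [← h2]
    exact Finset.sum_congr rfl fun n _ => by ring

end Step
end DirectionalWavelet

namespace DirectionalWavelet
-- Localization of the kernels of fixed order.
section Kernel
open Polynomial

/-- The kernel `∑ n, (2 * n + 1) * κ (n / N) * W n * (d / dx) ^ k P_n`. -/
noncomputable def legendreKernel (κ : ℝ → ℝ) (W : ℕ → ℝ) (k N : ℕ) (x : ℝ) : ℝ :=
  ∑ n ∈ Finset.range (2 * N + 1), (2 * (n : ℝ) + 1) * (κ ((n : ℝ) / N) * W n) *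
    (derivative^[k] (legendreP n)).eval x

theorem abs_legendreKernel_le (κ : ℝ → ℝ) (W : ℕ → ℝ) (k N : ℕ) :
    ∃ B : ℝ, 0 ≤ B ∧ ∀ x ∈ Set.Icc (-1 : ℝ) 1, |legendreKernel κ W k N x| ≤ B := by
  refine ⟨∑ n ∈ Finset.range (2 * N + 1), |(2 * (n : ℝ) + 1) * (κ ((n : ℝ) / N) * W n)| *
    (n : ℝ) ^ (2 * k), Finset.sum_nonneg fun n _ => by positivity, fun x hx => ?_⟩
  refine (Finset.abs_sum_le_sum_abs _ _).trans (Finset.sum_le_sum fun n _ => ?_)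
  rw [abs_mul]
  exact mul_le_mul_of_nonneg_left (abs_eval_iterate_derivative_legendreP_le k n hx) (abs_nonneg _)

variable {κ : ℝ → ℝ} {W : ℕ → ℝ} {k m r : ℕ}

theorem one_sub_pow_mul_legendreKernel_le_of_large (hκ : IsWindow r κ) (hm : 2 * m ≤ r)
    (hW : IsSymbol r (-(k : ℤ)) fun x => W x.2) :
    ∃ C : ℝ, ∃ N₀ : ℕ, 0 ≤ C ∧ ∀ N : ℕ, N₀ ≤ N → 1 ≤ N → ∀ x ∈ Set.Icc (-1 : ℝ) 1,
      (1 - x) ^ m * |legendreKernel κ W k N x| ≤ C * (N : ℝ) ^ (2 + k) / (N : ℝ) ^ (2 * m) := by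
  set g : ℕ × ℕ → ℝ := fun x => κ ((x.2 : ℝ) / ((x.1 : ℝ) + 1)) * W x.2 with hg
  have hs : IsSymbol 0 (0 + -(k : ℤ) - 2 * m) ((legendreStep k)^[m] g) :=
    IsSymbol.iterate_legendreStep k (r := 0) ((hκ.isSymbol.mul hW).of_le (by omega))
  obtain ⟨C, hC, hb⟩ := Asymptotics.IsBigO.exists_nonneg hs.isBigO
  obtain ⟨n₀, hn₀⟩ := eventually_sndAtTop_iff.1 hb.bound
  -- With `R` the scale, there are at most `4R` terms, `2n + 1 ≤ 3n`, and surviving indices satisfy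
  -- `R/4 ≤ n ≤ 3R`. The threshold on the scale ensures this despite the `m` steps widening the
  -- support, and also `n ≥ n₀`.
  refine ⟨4 * 3 * C * 3 ^ (1 + k) * 4 ^ (2 * m), 4 * m + 4 * n₀ + 4, by positivity,
    fun N hN _ x hx => ?_⟩
  -- The symbol calculus samples at `n / (N + 1)`, so the scale is written as `N + 1`.
  obtain ⟨N, rfl⟩ := Nat.exists_eq_add_of_le' (show 1 ≤ N by omega)
  set R : ℝ := ((N + 1 : ℕ) : ℝ) with hR
  have hR0 : 0 < R := by rw [hR]; positivity
  have hge : ∀ n, 2 * (N + 1) + 1 ≤ n → g (N, n) = 0 := fun n hn => by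
    have : κ ((n : ℝ) / ((N : ℝ) + 1)) = 0 := hκ.eq_zero (by positivity) fun h => by
      have := (div_le_iff₀ (by positivity)).1 h.2
      have hn' : ((2 * (N + 1) + 1 : ℕ) : ℝ) ≤ n := by exact_mod_cast hn
      push_cast at hn'
      linarith
    simp only [hg, this, zero_mul]
  have hlt : ∀ n, n < N / 2 + 1 → g (N, n) = 0 := fun n hn => by
    have : κ ((n : ℝ) / ((N : ℝ) + 1)) = 0 := hκ.eq_zero (by positivity) fun h => by
      have := (le_div_iff₀ (by positivity)).1 h.1
      have hn' : ((2 * n + 1 : ℕ) : ℝ) ≤ (N + 1 : ℕ) := by exact_mod_cast (by omega)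
      push_cast at hn'
      linarith
    simp only [hg, this, zero_mul]
  have hsum := sum_iterate_legendreStep k N (2 * (N + 1) + 1) m g x hge
  have hker : legendreKernel κ W k (N + 1) x = ∑ n ∈ Finset.range (2 * (N + 1) + 1),
      (2 * (n : ℝ) + 1) * g (N, n) * (derivative^[k] (legendreP n)).eval x := by
    simp only [legendreKernel, hg, Nat.cast_add, Nat.cast_one]
  have h1x : 0 ≤ 1 - x := by linarith [hx.2]
  rw [← abs_of_nonneg (pow_nonneg h1x m), ← abs_mul, hker, ← hsum]
  have hterm : ∀ n ∈ Finset.range (2 * (N + 1) + 1 + m),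
      |(2 * (n : ℝ) + 1) * (legendreStep k)^[m] g (N, n) *
        (derivative^[k] (legendreP n)).eval x| ≤
      3 * C * 3 ^ (1 + k) * 4 ^ (2 * m) * R ^ (1 + k) / R ^ (2 * m) := by
    intro n hn
    rw [Finset.mem_range] at hn
    by_cases hsmall : n + m < N / 2 + 1
    · rw [iterate_legendreStep_eq_zero_of_lt hlt hsmall, mul_zero, zero_mul, abs_zero]
      positivity
    have hn1 : n₀ ≤ n := by omega
    have hnR : R ≤ 4 * n := by rw [hR]; exact_mod_cast (by omega)
    have hnR' : (n : ℝ) ≤ 3 * R := by rw [hR]; exact_mod_cast (by omega)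
    have hn0 : (1 : ℝ) ≤ n := by exact_mod_cast (by omega)
    have hn00 : (0 : ℝ) < n := by linarith
    have h1 := hn₀ N n hn1
    rw [Real.norm_eq_abs, Real.norm_of_nonneg (by positivity)] at h1
    have h2 := abs_eval_iterate_derivative_legendreP_le k n hx
    rw [abs_mul, abs_mul, abs_of_nonneg (show 0 ≤ 2 * (n : ℝ) + 1 by positivity)]
    calc (2 * (n : ℝ) + 1) * |(legendreStep k)^[m] g (N, n)| *
          |(derivative^[k] (legendreP n)).eval x|
        ≤ (3 * n) * (C * (n : ℝ) ^ (0 + -(k : ℤ) - 2 * m)) * (n : ℝ) ^ (2 * k) := by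
          gcongr
          linarith
      _ = 3 * C * (n : ℝ) ^ (1 + k) * ((n : ℝ)⁻¹) ^ (2 * m) := by
          rw [show (0 : ℤ) + -(k : ℤ) - 2 * m = -((k + 2 * m : ℕ) : ℤ) by push_cast; ring, zpow_neg,
            zpow_natCast, inv_pow]
          field_simp
          ring
      _ ≤ 3 * C * (3 * R) ^ (1 + k) * (4 / R) ^ (2 * m) := by
          gcongr
          rw [inv_eq_one_div, div_le_div_iff₀ hn00 hR0]
          linarith
      _ = 3 * C * 3 ^ (1 + k) * 4 ^ (2 * m) * R ^ (1 + k) / R ^ (2 * m) := by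
          rw [mul_pow, div_pow]
          ring
  refine (Finset.abs_sum_le_sum_abs _ _).trans ((Finset.sum_le_card_nsmul _ _ _ hterm).trans ?_)
  rw [Finset.card_range, nsmul_eq_mul]
  have hcard : ((2 * (N + 1) + 1 + m : ℕ) : ℝ) ≤ 4 * R := by rw [hR]; exact_mod_cast (by omega)
  refine (mul_le_mul_of_nonneg_right hcard (by positivity)).trans (le_of_eq ?_)
  rw [show 2 + k = 1 + (1 + k) by ring, pow_add R 1, pow_one]
  ring

theorem one_sub_pow_mul_legendreKernel_le (hκ : IsWindow r κ) (hm : 2 * m ≤ r)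
    (hW : IsSymbol r (-(k : ℤ)) fun x => W x.2) :
    ∃ C : ℝ, 0 ≤ C ∧ ∀ N : ℕ, 1 ≤ N → ∀ x ∈ Set.Icc (-1 : ℝ) 1,
      (1 - x) ^ m * |legendreKernel κ W k N x| ≤ C * (N : ℝ) ^ (2 + k) / (N : ℝ) ^ (2 * m) := by
  obtain ⟨C, N₀, hC, h⟩ := one_sub_pow_mul_legendreKernel_le_of_large hκ hm hW
  -- The finitely many scales below `N₀` are absorbed into the constant through a crude bound for
  -- each `N`.
  choose B hB0 hB using abs_legendreKernel_le κ W k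
  have hS : ∀ N ∈ Finset.range N₀, 0 ≤ 2 ^ m * B N * (N : ℝ) ^ (2 * m) := fun N _ => by
    have := hB0 N; positivity
  refine ⟨C + ∑ N ∈ Finset.range N₀, 2 ^ m * B N * (N : ℝ) ^ (2 * m),
    add_nonneg hC (Finset.sum_nonneg hS), fun N hN x hx => ?_⟩
  have hN' : (1 : ℝ) ≤ N := by exact_mod_cast hN
  rcases le_or_gt N₀ N with hl | hl
  · refine (h N hl hN x hx).trans ?_
    gcongr
    exact le_add_of_nonneg_right (Finset.sum_nonneg hS)
  · have h1 := Finset.single_le_sum hS (Finset.mem_range.2 hl)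
    rw [le_div_iff₀ (by positivity)]
    have h1x : 0 ≤ 1 - x := by linarith [hx.2]
    calc (1 - x) ^ m * |legendreKernel κ W k N x| * (N : ℝ) ^ (2 * m)
        ≤ 2 ^ m * B N * (N : ℝ) ^ (2 * m) := by
          gcongr
          · linarith [hx.1]
          · exact hB N x hx
      _ ≤ (C + ∑ N ∈ Finset.range N₀, 2 ^ m * B N * (N : ℝ) ^ (2 * m)) := by linarith
      _ ≤ _ := le_mul_of_one_le_right (add_nonneg hC (Finset.sum_nonneg hS)) (one_le_pow₀ hN')

theorem abs_legendreKernel_cos_le {q : ℕ} (hκ : IsWindow r κ) (hq : q + 1 ≤ r)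
    (hW : IsSymbol r (-(k : ℤ)) fun x => W x.2) :
    ∃ C : ℝ, 0 ≤ C ∧ ∀ N : ℕ, 1 ≤ N → ∀ θ ∈ Set.Icc (0 : ℝ) Real.pi,
      |legendreKernel κ W k N (Real.cos θ)| ≤
        C * (N : ℝ) ^ (2 + k) / (1 + (N : ℝ) * θ) ^ q := by
  -- The least `m` with `q ≤ 2m`; it satisfies `2m ≤ q + 1 ≤ r`.
  set m := (q + 1) / 2 with hm
  obtain ⟨C, hC, h⟩ := one_sub_pow_mul_legendreKernel_le (m := m) hκ (by omega) hW
  obtain ⟨D, hD, h'⟩ := one_sub_pow_mul_legendreKernel_le (m := 0) hκ (by omega) hW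
  refine ⟨2 ^ (2 * m) * (D + 5 ^ m * C), by positivity, fun N hN θ hθ => ?_⟩
  have hN' : (1 : ℝ) ≤ N := by exact_mod_cast hN
  have hx : Real.cos θ ∈ Set.Icc (-1 : ℝ) 1 := ⟨Real.neg_one_le_cos θ, Real.cos_le_one θ⟩
  have hθ0 := hθ.1
  have hNθ : 0 ≤ (N : ℝ) * θ := by positivity
  have h1 := h N hN _ hx
  have h2 := h' N hN _ hx
  simp only [pow_zero, one_mul, mul_zero, div_one] at h2
  set S := |legendreKernel κ W k N (Real.cos θ)| with hS
  have hS0 : 0 ≤ S := abs_nonneg _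
  -- From `cos θ ≤ 1 - (2/π²) θ²` on `[0, π]` and `π² ≤ 10`.
  have hcos : θ ^ 2 ≤ 5 * (1 - Real.cos θ) := by
    have h3 := Real.cos_le_one_sub_mul_cos_sq (x := θ) (by rw [abs_of_nonneg hθ0]; exact hθ.2)
    have hpi : Real.pi ^ 2 ≤ 10 := by nlinarith [Real.pi_lt_d2, Real.pi_pos]
    have h4 : 2 / 10 * θ ^ 2 ≤ 2 / Real.pi ^ 2 * θ ^ 2 := by
      gcongr
    linarith
  have h3 : ((N : ℝ) * θ) ^ (2 * m) * S ≤ 5 ^ m * C * (N : ℝ) ^ (2 + k) := by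
    rw [le_div_iff₀ (by positivity)] at h1
    calc ((N : ℝ) * θ) ^ (2 * m) * S = (θ ^ 2) ^ m * S * (N : ℝ) ^ (2 * m) := by
          rw [mul_pow, pow_mul θ]; ring
      _ ≤ (5 * (1 - Real.cos θ)) ^ m * S * (N : ℝ) ^ (2 * m) := by gcongr
      _ = 5 ^ m * ((1 - Real.cos θ) ^ m * S * (N : ℝ) ^ (2 * m)) := by rw [mul_pow]; ring
      _ ≤ 5 ^ m * (C * (N : ℝ) ^ (2 + k)) := by gcongr
      _ = _ := by ring
  rw [le_div_iff₀ (by positivity)]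
  have h4 : (1 + (N : ℝ) * θ) ^ q ≤ 2 ^ (2 * m) * (1 + ((N : ℝ) * θ) ^ (2 * m)) := by
    refine (pow_le_pow_right₀ (by linarith) (show q ≤ 2 * m by omega)).trans ?_
    rcases le_total ((N : ℝ) * θ) 1 with h | h
    · calc (1 + (N : ℝ) * θ) ^ (2 * m) ≤ 2 ^ (2 * m) := by gcongr; linarith
        _ ≤ _ := le_mul_of_one_le_right (by positivity) (by linarith [pow_nonneg hNθ (2 * m)])
    · calc (1 + (N : ℝ) * θ) ^ (2 * m) ≤ (2 * ((N : ℝ) * θ)) ^ (2 * m) := by gcongr; linarith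
        _ = 2 ^ (2 * m) * ((N : ℝ) * θ) ^ (2 * m) := by rw [mul_pow]
        _ ≤ _ := by gcongr; linarith
  calc S * (1 + (N : ℝ) * θ) ^ q ≤ S * (2 ^ (2 * m) * (1 + ((N : ℝ) * θ) ^ (2 * m))) := by gcongr
    _ = 2 ^ (2 * m) * (S + ((N : ℝ) * θ) ^ (2 * m) * S) := by ring
    _ ≤ 2 ^ (2 * m) * (D * (N : ℝ) ^ (2 + k) + 5 ^ m * C * (N : ℝ) ^ (2 + k)) := by gcongr
    _ = _ := by ring

end Kernel
end DirectionalWavelet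

namespace DirectionalWavelet
-- The coefficient weights as symbols.
section Weight
open Filter Asymptotics

theorem factorial_div_factorial_eq {n j : ℕ} (h : j ≤ n) :
    ((n - j).factorial : ℝ) / ((n + j).factorial : ℝ) =
      (∏ i ∈ Finset.range (2 * j), ((n : ℝ) + ((i : ℝ) + 1 - j)))⁻¹ := by
  have h1 := Nat.factorial_mul_ascFactorial (n - j) (2 * j)
  rw [Nat.ascFactorial_eq_prod_range, show n - j + 2 * j = n + j by omega] at h1
  have h2 : ((∏ i ∈ Finset.range (2 * j), (n - j + 1 + i) : ℕ) : ℝ) =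
      ∏ i ∈ Finset.range (2 * j), ((n : ℝ) + ((i : ℝ) + 1 - j)) := by
    push_cast [Nat.cast_sub h]
    exact Finset.prod_congr rfl fun i _ => by ring
  rw [← h1, Nat.cast_mul, h2]
  have h3 : ((n - j).factorial : ℝ) ≠ 0 := by positivity
  rw [div_mul_cancel_left₀ h3]

/-- For `n ≥ j` the quotient is the reciprocal of a product of `2j` translates of `n`, hence of
order `-2j`; the square root halves this. -/
theorem isSymbol_sqrt_factorial_div (j r : ℕ) :
    IsSymbol r (-(j : ℤ)) fun x => √(((x.2 - j).factorial : ℝ) / ((x.2 + j).factorial : ℝ)) := by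
  set a : ℕ → ℝ := fun i => (i : ℝ) + 1 - j with ha
  have h1 := isSymbol_prod_snd_add (Finset.range (2 * j)) a r
  have h2 := zpow_isBigO_prod_snd_add (Finset.range (2 * j)) a
  have h3 := h1.inv h2
  have h4 := h1.isBigO.inv_rev ((IsSymbol.eventually_ne_zero h2).mono fun x hx h0 => absurd h0 hx)
  rw [Finset.card_range, show (-((2 * j : ℕ) : ℤ)) = 2 * -(j : ℤ) by push_cast; ring] at h3
  simp only [← zpow_neg, Finset.card_range] at h4
  rw [show (-((2 * j : ℕ) : ℤ)) = 2 * -(j : ℤ) by push_cast; ring] at h4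
  have h5 : (fun x : ℕ × ℕ => ((x.2 - j).factorial : ℝ) / ((x.2 + j).factorial : ℝ))
      =ᶠ[sndAtTop] fun x => (∏ i ∈ Finset.range (2 * j), ((x.2 : ℝ) + a i))⁻¹ :=
    eventually_sndAtTop j fun N n hn => factorial_div_factorial_eq hn
  exact (h3.congr' h5.symm).sqrt (h4.trans_eventuallyEq h5.symm)
    (Eventually.of_forall fun x => by positivity)

/-- The modulus of the coefficients of the wavelet of order `k`, relative to
`(2 * n + 1) * κ (n / N)`. -/
noncomputable def waveletWeight (K : ℕ) (k : ℤ) (n : ℕ) : ℝ :=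
  if k.natAbs ≤ n then
    √(1 / 2 ^ binomTop K n * ((binomTop K n).choose (((binomTop K n : ℤ) - k) / 2).toNat : ℝ)) *
      √(((n - k.natAbs).factorial : ℝ) / ((n + k.natAbs).factorial : ℝ))
  else 0

/-- Once `n ≥ K`, `binomTop K n` is `K - 1` for either parity, so the directionality factor is
constant in `n` and only the factorial quotient matters. -/
theorem isSymbol_waveletWeight (K : ℕ) (k : ℤ) (r : ℕ) :
    IsSymbol r (-(k.natAbs : ℤ)) fun x => waveletWeight K k x.2 := by
  refine ((isSymbol_sqrt_factorial_div k.natAbs r).const_mul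
    √(1 / 2 ^ (K - 1) * ((K - 1).choose (((K - 1 : ℕ) - k) / 2).toNat : ℝ))).congr'
    (eventually_sndAtTop (max K k.natAbs) fun N n hn => ?_)
  have h1 : K ≤ n := (le_max_left _ _).trans hn
  have h2 : k.natAbs ≤ n := (le_max_right _ _).trans hn
  have h3 : binomTop K n = K - 1 := by
    unfold binomTop
    split_ifs
    · exact min_eq_left (by omega)
    · exact min_eq_left (by omega)
  simp only [waveletWeight, if_pos h2, h3]

end Weight

/-! ### Expansion of the wavelet into kernels by order. -/

section Expansion
open Polynomial

theorem assocLegendreNat_cos (n j : ℕ) {θ : ℝ} (hθ : θ ∈ Set.Icc 0 Real.pi) :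
    assocLegendreNat n j (Real.cos θ) =
      Real.sin θ ^ j * (derivative^[j] (legendreP n)).eval (Real.cos θ) := by
  unfold assocLegendreNat
  rw [← Real.sin_sq, Real.sqrt_sq (Real.sin_nonneg_of_mem_Icc hθ)]

/-- The sign of `Y_n^k` relative to the associated Legendre function of order `|k|`. -/
noncomputable def harmonicSign (k : ℤ) : ℂ := if 0 ≤ k then (-1) ^ k else 1

theorem norm_harmonicSign (k : ℤ) : ‖harmonicSign k‖ = 1 := by
  unfold harmonicSign
  split_ifs <;> simp

theorem sphericalHarmonic_eq {n : ℕ} {k : ℤ} (hk : k.natAbs ≤ n) {θ : ℝ}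
    (hθ : θ ∈ Set.Icc 0 Real.pi) (φ : ℝ) :
    sphericalHarmonic n k θ φ = harmonicSign k * Complex.exp (Complex.I * k * φ) *
      ((√((2 * (n : ℝ) + 1) / (4 * Real.pi)) *
        √(((n - k.natAbs).factorial : ℝ) / ((n + k.natAbs).factorial : ℝ)) *
        (Real.sin θ ^ k.natAbs *
          (derivative^[k.natAbs] (legendreP n)).eval (Real.cos θ)) : ℝ) : ℂ) := by
  have hA : 0 ≤ (2 * (n : ℝ) + 1) / (4 * Real.pi) := by have := Real.pi_pos; positivity
  unfold sphericalHarmonic harmonicSign assocLegendre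
  rw [Real.sqrt_mul hA]
  obtain ⟨j, rfl | rfl⟩ := k.eq_nat_or_neg
  · rw [Int.natAbs_natCast] at hk ⊢
    rw [if_pos (Int.natCast_nonneg j), if_pos (Int.natCast_nonneg j), Int.toNat_natCast,
      show ((n : ℤ) - j).toNat = n - j by omega, show ((n : ℤ) + j).toNat = n + j by omega,
      assocLegendreNat_cos n j hθ]
    push_cast
    ring
  · rw [Int.natAbs_neg, Int.natAbs_natCast] at hk ⊢
    rcases Nat.eq_zero_or_pos j with rfl | hj
    · simp [assocLegendreNat_cos n 0 hθ]
    rw [if_neg (by omega), if_neg (by omega), neg_neg, Int.toNat_natCast,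
      show ((n : ℤ) - -(j : ℤ)).toNat = n + j by omega,
      show ((n : ℤ) + -(j : ℤ)).toNat = n - j by omega, assocLegendreNat_cos n j hθ]
    set a : ℝ := ((n - j).factorial : ℝ) with ha
    set b : ℝ := ((n + j).factorial : ℝ) with hb
    have ha0 : 0 < a := by positivity
    have hb0 : 0 < b := by positivity
    -- For negative order, the factorial quotient in `assocLegendre` inverts the one in the
    -- normalization; the two signs `(-1)^k` cancel as well.
    have h1 : √(b / a) * (a / b) = √(a / b) := by
      rw [Real.sqrt_div hb0.le, Real.sqrt_div ha0.le]
      have := Real.sq_sqrt ha0.le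
      have := Real.sq_sqrt hb0.le
      have := Real.sqrt_pos.2 ha0
      have := Real.sqrt_pos.2 hb0
      field_simp
      nlinarith
    have h2 : ((-1 : ℂ) ^ (-(j : ℤ))) * (-1 : ℂ) ^ (-(j : ℤ)) = 1 := by
      rw [← mul_zpow]; norm_num
    rw [← h1]
    generalize Real.sin θ ^ j * (derivative^[j] (legendreP n)).eval (Real.cos θ) = S
    push_cast
    linear_combination ((√((2 * (n : ℝ) + 1) / (4 * Real.pi)) : ℂ) * (√(b / a) : ℂ) *
      ((a : ℂ) / (b : ℂ)) * (S : ℂ) * Complex.exp (Complex.I * (-(j : ℂ)) * φ)) * h2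

/-- The part of the coefficient of order `k` of a wavelet that does not depend on the degree. -/
noncomputable def waveletPhase (K : ℕ) (k : ℤ) (φ : ℝ) : ℂ :=
  ((√(8 * Real.pi ^ 2) * √(4 * Real.pi))⁻¹ : ℝ) * (eta K * nu K k) *
    (harmonicSign k * Complex.exp (Complex.I * k * φ))

theorem norm_waveletPhase_le (K : ℕ) (k : ℤ) (φ : ℝ) : ‖waveletPhase K k φ‖ ≤ 1 := by
  have h1 : ‖eta K‖ = 1 := by unfold eta; split_ifs <;> simp
  have h2 : ‖nu K k‖ ≤ 1 := by unfold nu; split_ifs <;> simp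
  have h3 : ‖Complex.exp (Complex.I * k * φ)‖ = 1 := by
    rw [show Complex.I * k * φ = ((k * φ : ℝ) : ℂ) * Complex.I by push_cast; ring]
    exact Complex.norm_exp_ofReal_mul_I _
  have h4 : 1 ≤ √(8 * Real.pi ^ 2) * √(4 * Real.pi) := by
    have := Real.pi_gt_three
    refine one_le_mul_of_one_le_of_one_le ?_ ?_ <;> rw [Real.one_le_sqrt] <;> nlinarith
  unfold waveletPhase
  rw [norm_mul, norm_mul, norm_mul, norm_mul, h1, h3, norm_harmonicSign, one_mul, mul_one, mul_one,
    Complex.norm_real, Real.norm_of_nonneg (by positivity)]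
  exact mul_le_one₀ (inv_le_one_of_one_le₀ h4) (norm_nonneg _) h2

theorem wavelet_term_eq (κ : ℝ → ℝ) {K N n : ℕ} {k : ℤ} (hk : k.natAbs ≤ n) {θ : ℝ}
    (hθ : θ ∈ Set.Icc 0 Real.pi) (φ : ℝ) (hkK : |k| ≤ (K : ℤ) - 1) :
    (√((2 * (n : ℝ) + 1) / (8 * Real.pi ^ 2)) : ℂ) * (κ ((n : ℝ) / (N : ℝ)) : ℂ) *
      directionality K n k * sphericalHarmonic n k θ φ =
    waveletPhase K k φ * ((Real.sin θ ^ k.natAbs * ((2 * (n : ℝ) + 1) *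
      (κ ((n : ℝ) / N) * waveletWeight K k n) *
      (derivative^[k.natAbs] (legendreP n)).eval (Real.cos θ)) : ℝ) : ℂ) := by
  rw [sphericalHarmonic_eq hk hθ]
  unfold directionality waveletPhase waveletWeight
  rw [if_pos hkK, if_pos hk]
  have hn : 0 ≤ 2 * (n : ℝ) + 1 := by positivity
  have h1 : √((2 * (n : ℝ) + 1) / (8 * Real.pi ^ 2)) * √((2 * (n : ℝ) + 1) / (4 * Real.pi)) =
      (√(8 * Real.pi ^ 2) * √(4 * Real.pi))⁻¹ * (2 * (n : ℝ) + 1) := by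
    rw [Real.sqrt_div hn, Real.sqrt_div hn, div_mul_div_comm, Real.mul_self_sqrt hn, div_eq_inv_mul]
  have h2 := congrArg (fun t : ℝ => (t : ℂ)) h1
  simp only [Complex.ofReal_mul] at h2
  simp only [Complex.ofReal_mul]
  linear_combination ((κ ((n : ℝ) / (N : ℝ)) : ℂ) * (eta K * nu K k * (√(1 / 2 ^ binomTop K n *
    ((binomTop K n).choose (((binomTop K n : ℤ) - k) / 2).toNat : ℝ)) : ℂ)) *
    (harmonicSign k * Complex.exp (Complex.I * k * φ)) *
    (√(((n - k.natAbs).factorial : ℝ) / ((n + k.natAbs).factorial : ℝ)) : ℂ) *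
    (((Real.sin θ ^ k.natAbs : ℝ) : ℂ) *
      Complex.ofReal ((derivative^[k.natAbs] (legendreP n)).eval (Real.cos θ)))) * h2

theorem wavelet_eq_sum {r : ℕ} {κ : ℝ → ℝ} (hκ : IsWindow r κ) {K N : ℕ} (hN : 1 ≤ N)
    {θ : ℝ} (hθ : θ ∈ Set.Icc 0 Real.pi) (φ : ℝ) :
    wavelet κ K N θ φ = ∑ k ∈ Finset.Icc (-((K : ℤ) - 1)) ((K : ℤ) - 1), waveletPhase K k φ *
      ((Real.sin θ ^ k.natAbs *
        legendreKernel κ (waveletWeight K k) k.natAbs N (Real.cos θ) : ℝ) : ℂ) := by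
  have hN' : (0 : ℝ) < N := by exact_mod_cast hN
  unfold wavelet legendreKernel
  rw [tsum_eq_sum (s := Finset.range (2 * N + 1)) fun n hn => ?_]
  swap
  · have : κ ((n : ℝ) / N) = 0 := hκ.eq_zero (by positivity) fun h => by
      have h1 := (div_le_iff₀ hN').1 h.2
      have h2 : n ≤ 2 * N := by exact_mod_cast h1
      exact hn (Finset.mem_range.2 (by omega))
    exact Finset.sum_eq_zero fun k _ => by rw [this]; simp
  simp only [Finset.mul_sum, Complex.ofReal_sum]
  rw [Finset.sum_comm (s := Finset.Icc _ _)]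
  refine Finset.sum_congr rfl fun n _ => ?_
  set F : ℤ → ℂ := fun k => waveletPhase K k φ * ((Real.sin θ ^ k.natAbs * ((2 * (n : ℝ) + 1) *
    (κ ((n : ℝ) / N) * waveletWeight K k n) *
    (derivative^[k.natAbs] (legendreP n)).eval (Real.cos θ)) : ℝ) : ℂ) with hF
  calc _ = ∑ k ∈ Finset.Icc (-(n : ℤ)) n, if |k| ≤ (K : ℤ) - 1 then F k else 0 := by
        refine Finset.sum_congr rfl fun k hk => ?_
        rw [Finset.mem_Icc] at hk
        split_ifs with h
        · exact wavelet_term_eq κ (by omega) hθ φ h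
        · simp [directionality, h]
    -- The range of orders is made independent of `n`, so that the two sums can be exchanged;
    -- `waveletWeight` is zero for `|k| > n`.
    _ = ∑ k ∈ Finset.Icc (-((K : ℤ) - 1)) ((K : ℤ) - 1), if k.natAbs ≤ n then F k else 0 := by
        rw [← Finset.sum_filter, ← Finset.sum_filter]
        refine Finset.sum_congr ?_ fun _ _ => rfl
        ext k
        simp only [Finset.mem_filter, Finset.mem_Icc, abs_le]
        omega
    _ = _ := by
        refine Finset.sum_congr rfl fun k _ => ?_
        by_cases h : k.natAbs ≤ n
        · rw [if_pos h]
        · rw [if_neg h]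
          simp [hF, waveletWeight, h]

/-- The localization bound for directional wavelets. -/
theorem norm_wavelet_le {κ : ℝ → ℝ} {r : ℕ} (hκ : IsWindow r κ) (K : ℕ) {q : ℕ}
    (hq : q + 1 ≤ r) :
    ∃ C : ℝ, 0 ≤ C ∧ ∀ N : ℕ, 1 ≤ N → ∀ θ ∈ Set.Icc (0 : ℝ) Real.pi, ∀ φ : ℝ,
      ‖wavelet κ K N θ φ‖ ≤ C * (N : ℝ) ^ 2 / (1 + (N : ℝ) * θ) ^ q *
        ∑ k ∈ Finset.range K, ((N : ℝ) * Real.sin θ) ^ k := by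
  choose C hC0 hC using fun k : ℤ =>
    abs_legendreKernel_cos_le hκ hq (isSymbol_waveletWeight K k r)
  refine ⟨∑ k ∈ Finset.Icc (-((K : ℤ) - 1)) ((K : ℤ) - 1), C k,
    Finset.sum_nonneg fun k _ => hC0 k, fun N hN θ hθ φ => ?_⟩
  have hs : 0 ≤ Real.sin θ := Real.sin_nonneg_of_mem_Icc hθ
  have hθ0 := hθ.1
  rw [wavelet_eq_sum hκ hN hθ, Finset.sum_mul, Finset.sum_div, Finset.sum_mul]
  refine (norm_sum_le _ _).trans (Finset.sum_le_sum fun k hk => ?_)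
  rw [Finset.mem_Icc] at hk
  have h1 : ((N : ℝ) * Real.sin θ) ^ k.natAbs ≤
      ∑ k ∈ Finset.range K, ((N : ℝ) * Real.sin θ) ^ k :=
    Finset.single_le_sum (f := fun j => ((N : ℝ) * Real.sin θ) ^ j) (fun j _ => by positivity)
      (Finset.mem_range.2 (by omega))
  have hCk := hC0 k
  rw [norm_mul, Complex.norm_real, Real.norm_eq_abs, abs_mul, abs_of_nonneg (pow_nonneg hs _)]
  calc _ ≤ 1 * (Real.sin θ ^ k.natAbs *
        (C k * (N : ℝ) ^ (2 + k.natAbs) / (1 + (N : ℝ) * θ) ^ q)) := by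
        gcongr
        · exact norm_waveletPhase_le K k φ
        · exact hC k N hN θ hθ
    _ = C k * (N : ℝ) ^ 2 / (1 + (N : ℝ) * θ) ^ q * ((N : ℝ) * Real.sin θ) ^ k.natAbs := by
        rw [pow_add, mul_pow]; ring
    _ ≤ _ := by gcongr

end Expansion
end DirectionalWavelet
-- The two localization bounds.
theorem mainTheorem3 (κ : ℝ → ℝ) (K q : ℕ) (hK : 1 ≤ K) (hq : 1 ≤ q)
    (hκ : DirectionalWavelet.IsWindow (3 * q - 1) κ) :
    ∃ c : ℝ, 0 < c ∧
      ∀ N : ℕ, 1 ≤ N → ∀ θ ∈ Set.Icc (0 : ℝ) Real.pi, ∀ φ ∈ Set.Ico (0 : ℝ) (2 * Real.pi),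
        ‖DirectionalWavelet.wavelet κ K N θ φ‖ ≤
            c * (N : ℝ) ^ 2 / (1 + (N : ℝ) * θ) ^ q *
              ∑ k ∈ Finset.range K, ((N : ℝ) * Real.sin θ) ^ k ∧
        ‖DirectionalWavelet.wavelet κ K N θ φ‖ ≤
            c * (N : ℝ) ^ 2 / (1 + (N : ℝ) * θ) ^ ((q : ℤ) + 1 - (K : ℤ)) := by
  -- The argument needs only `q + 1` derivatives, and `q + 1 ≤ 3q - 1` because `q ≥ 1`.
  obtain ⟨C, hC0, hC⟩ := DirectionalWavelet.norm_wavelet_le hκ K (q := q) (by omega)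
  -- In the constant, `C + 1` secures strict positivity and `K` counts the terms of the sum over
  -- orders, each at most `(1 + Nθ)^{K-1}`.
  have hK' : (1 : ℝ) ≤ K := by exact_mod_cast hK
  refine ⟨(C + 1) * K, by positivity, fun N hN θ hθ φ _ => ?_⟩
  have hs : 0 ≤ Real.sin θ := Real.sin_nonneg_of_mem_Icc hθ
  have hθ0 := hθ.1
  have h := hC N hN θ hθ φ
  have hCK : C ≤ (C + 1) * K := by nlinarith
  have hpos : 0 < 1 + (N : ℝ) * θ := by positivity
  refine ⟨h.trans (by gcongr), h.trans ?_⟩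
  have hsum : ∑ k ∈ Finset.range K, ((N : ℝ) * Real.sin θ) ^ k ≤
      K * (1 + (N : ℝ) * θ) ^ (K - 1) := by
    refine (Finset.sum_le_card_nsmul _ _ ((1 + (N : ℝ) * θ) ^ (K - 1)) fun k hk => ?_).trans_eq
      (by rw [Finset.card_range, nsmul_eq_mul])
    rw [Finset.mem_range] at hk
    calc ((N : ℝ) * Real.sin θ) ^ k ≤ (1 + (N : ℝ) * θ) ^ k := by
          gcongr
          have := mul_le_mul_of_nonneg_left (Real.sin_le hθ0) (Nat.cast_nonneg (α := ℝ) N)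
          linarith
      _ ≤ _ := pow_le_pow_right₀ (le_add_of_nonneg_right (by positivity)) (by omega)
  have hz : (1 + (N : ℝ) * θ) ^ ((q : ℤ) + 1 - (K : ℤ)) =
      (1 + (N : ℝ) * θ) ^ q / (1 + (N : ℝ) * θ) ^ (K - 1) := by
    rw [show (q : ℤ) + 1 - (K : ℤ) = (q : ℤ) - ((K - 1 : ℕ) : ℤ) by omega, zpow_sub₀ hpos.ne',
      zpow_natCast, zpow_natCast]
  rw [hz]
  calc _ ≤ C * (N : ℝ) ^ 2 / (1 + (N : ℝ) * θ) ^ q * (K * (1 + (N : ℝ) * θ) ^ (K - 1)) := by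
        gcongr
    _ ≤ (C + 1) * (N : ℝ) ^ 2 / (1 + (N : ℝ) * θ) ^ q * (K * (1 + (N : ℝ) * θ) ^ (K - 1)) := by
        gcongr
        linarith
    _ = _ := by
        field_simp
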